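/- A $\mathbb{Z}_4$-code of length $n$ is a submodule $\mathcal{C}$ of $\mathbb{Z}_4^n$. It is self-dual if $\mathcal{C}=\mathcal{C}^\perp=\{x\in\mathbb{Z}_4^n : \sum_i x_iy_i=0 \text{ for all } y\in\mathcal{C}\}$. The Euclidean weight of $x\in\mathbb{Z}_4^n$ is $n_1(x)+4n_2(x)+n_3(x)$, where $n_\alpha(x)$ is the number of coordinates of $x$ equal to $\alpha$. A $\mathbb{Z}_4$-code is Type II if it is self-dual and the Euclidean weights of all its codewords are divisible by $8$; a Type II code of length $n$ is extremal if the smallest Euclidean weight of its nonzero codewords is $8\lfloor n/24\rfloor+8$ (that is, $16$ for $n=24$). The residue code of $\mathcal{C}$ is the binary code $\mathcal{C}_1=\{x \bmod 2 : x\in\mathcal{C}\}\subseteq\mathbb{F}_2^n$. Two $\mathbb{Z}_4$-codes of length $n$ are equivalent if one is obtained from the other by permuting the coordinates and, if necessary, changing the signs of certain coordinates. **Proposition.** Up to equivalence, there is exactly one extremal Type II $\mathbb{Z}_4$-code of length $24$ whose residue code has dimension $6$ over $\mathbb{F}_2$. It is the code $\mathcal{C}^\natural$ generated over $\mathbb{Z}_4$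 by the rows of the matrix $$ \left[\begin{array}{cccccccccccccccccccccccc} 1 & 1 & 1 & 1 & 1 & 1 & 1 & 1 & 1 & 1 & 1 & 1 & 1 & 1 & 1 & 1 & 0 & 0 & 0 & 0 & 0 & 0 & 0 & 0 \\ 0 & 2 & 0 & 0 & 0 & 0 & 0 & 0 & 1 & 1 & 1 & 1 & 3 & 1 & 1 & 1 & 0 & 0 & 0 & 2 & 0 & 0 & 0 & 0 \\ 1 & 1 & 1 & 1 & 1 & 1 & 1 & 1 & 0 & 0 & 0 & 0 & 0 & 0 & 0 & 0 & 1 & 1 & 1 & 1 & 1 & 1 & 1 & 1 \\ 0 & 1 & 0 & 0 & 1 & 0 & 1 & 1 & 1 & 0 & 1 & 3 & 0 & 1 & 0 & 2 & 1 & 0 & 1 & 1 & 0 & 1 & 0 & 0 \\ 1 & 1 & 1 & 0 & 0 & 0 & 0 & 1 & 1 & 1 & 3 & 0 & 0 & 2 & 0 & 1 & 0 & 0 & 0 & 1 & 1 & 1 & 1 & 0 \\ 0 & 1 & 1 & 1 & 1 & 0 & 0 & 0 & 3 & 0 & 2 & 0 & 0 & 1 & 1 & 1 & 0 & 1 & 1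 & 1 & 1 & 0 & 0 & 0 \\ 0 & 0 & 0 & 0 & 0 & 0 & 0 & 0 & 2 & 0 & 2 & 2 & 0 & 2 & 0 & 0 & 0 & 0 & 0 & 0 & 0 & 0 & 0 & 0 \\ 0 & 0 & 0 & 0 & 0 & 0 & 0 & 0 & 2 & 2 & 2 & 0 & 0 & 0 & 0 & 2 & 0 & 0 & 0 & 0 & 0 & 0 & 0 & 0 \\ 0 & 0 & 0 & 0 & 0 & 0 & 0 & 0 & 2 & 0 & 0 & 0 & 0 & 2 & 2 & 2 & 0 & 0 & 0 & 0 & 0 & 0 & 0 & 0 \\ 0 & 2 & 0 & 0 & 2 & 0 & 2 & 2 & 0 & 0 & 0 & 0 & 0 & 0 & 0 & 0 & 0 & 0 & 0 & 0 & 0 & 0 & 0 & 0 \\ 2 & 2 & 2 & 0 & 0 & 0 & 0 & 2 & 0 & 0 & 0 & 0 & 0 & 0 & 0 & 0 & 0 & 0 & 0 & 0 & 0 & 0 & 0 & 0 \\ 0 & 2 & 2 & 2 & 2 & 0 & 0 & 0 & 0 & 0 & 0 & 0 & 0 & 0 & 0 & 0 & 0 & 0 & 0 & 0 & 0 & 0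 & 0 & 0 \\ 0 & 2 & 0 & 0 & 0 & 0 & 0 & 2 & 2 & 0 & 2 & 0 & 0 & 0 & 0 & 0 & 0 & 0 & 0 & 0 & 0 & 0 & 0 & 0 \\ 0 & 2 & 0 & 0 & 2 & 0 & 0 & 0 & 2 & 0 & 0 & 0 & 0 & 2 & 0 & 0 & 0 & 0 & 0 & 0 & 0 & 0 & 0 & 0 \\ 0 & 2 & 2 & 0 & 0 & 0 & 0 & 0 & 2 & 0 & 0 & 0 & 0 & 0 & 0 & 2 & 0 & 0 & 0 & 0 & 0 & 0 & 0 & 0 \\ 0 & 2 & 0 & 0 & 0 & 0 & 0 & 2 & 0 & 0 & 0 & 0 & 0 & 0 & 0 & 0 & 0 & 0 & 0 & 2 & 0 & 2 & 0 & 0 \\ 0 & 2 & 0 & 0 & 2 & 0 & 0 & 0 & 0 & 0 & 0 & 0 & 0 & 0 & 0 & 0 & 0 & 0 & 2 & 2 & 0 & 0 & 0 & 0 \\ 0 & 2 & 2 & 0 & 0 & 0 & 0 & 0 & 0 & 0 & 0 & 0 & 0 & 0 & 0 & 0 & 0 & 0 & 0 & 2 & 2 & 0 & 0 & 0 \end{array}\right].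 $$ In other words, $\mathcal{C}^\natural$ is an extremal Type II code whose residue code has dimension $6$, and every extremal Type II $\mathbb{Z}_4$-code of length $24$ whose residue code has dimension $6$ is equivalent to $\mathcal{C}^\natural$. -/

import Mathlib

/-- A (linear) `ℤ₄`-code of length `n`: a submodule of `ℤ₄ⁿ`. -/
abbrev Z4Code (n : ℕ) : Type := Submodule (ZMod 4) (Fin n → ZMod 4)

/-- A (linear) binary code of length `n`: a subspace of `𝔽₂ⁿ`. -/
abbrev BinaryCode (n : ℕ) : Type := Submodule (ZMod 2) (Fin n → ZMod 2)

namespace Z4Code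

/-- Coordinatewise reduction modulo `2`, from `ℤ₄ⁿ` to `ℤ₂ⁿ`. -/
def reduce {n : ℕ} (x : Fin n → ZMod 4) : Fin n → ZMod 2 :=
  fun i => ZMod.castHom (show 2 ∣ 4 by norm_num) (ZMod 2) (x i)

/-- The residue code `{x mod 2 ∣ x ∈ C}` of a `ℤ₄`-code `C`, a binary code. -/
def residue {n : ℕ} (C : Z4Code n) : BinaryCode n where
  carrier := {a | ∃ x ∈ C, reduce x = a}
  zero_mem' := ⟨0, C.zero_mem, by ext i; simp [reduce]⟩
  add_mem' := by
    rintro _ _ ⟨x, hx, rfl⟩ ⟨y, hy, rfl⟩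
    exact ⟨x + y, C.add_mem hx hy, by ext i; simp only [reduce, Pi.add_apply, map_add]⟩
  smul_mem' := by
    rintro c _ ⟨x, hx, rfl⟩
    obtain ⟨d, rfl⟩ := ZMod.castHom_surjective (show 2 ∣ 4 by norm_num) c
    exact ⟨d • x, C.smul_mem d hx, by
      ext i; simp only [reduce, Pi.smul_apply, smul_eq_mul, map_mul]⟩

/-- The dual code of `C` for the standard inner product on `ℤ₄ⁿ`. -/
def dual {n : ℕ} (C : Z4Code n) : Z4Code n where
  carrier := {x | ∀ y ∈ C, x ⬝ᵥ y = 0}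
  zero_mem' := fun y _ => zero_dotProduct y
  add_mem' := fun ha hb y hy => by rw [add_dotProduct, ha y hy, hb y hy, add_zero]
  smul_mem' := fun c x hx y hy => by rw [smul_dotProduct, hx y hy, smul_zero]

/-- A code is self-dual if it is equal to its dual code. -/
def IsSelfDual {n : ℕ} (C : Z4Code n) : Prop := C = C.dual

/-- The Euclidean weight `n₁(x) + 4 n₂(x) + n₃(x)`, where `n_α(x)` is the number of coordinates
of `x` equal to `α`. -/
def euclideanWeight {n : ℕ} (x : Fin n → ZMod 4) : ℕ :=
  (Finset.univ.filter fun i => x i = 1).card + 4 * (Finset.univ.filter fun i => x i = 2).card +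
    (Finset.univ.filter fun i => x i = 3).card

/-- A `ℤ₄`-code is Type II if it is self-dual and all its Euclidean weights are divisible by `8`. -/
def IsTypeII {n : ℕ} (C : Z4Code n) : Prop :=
  C.IsSelfDual ∧ ∀ x ∈ C, 8 ∣ euclideanWeight x

/-- A Type II code of length `n` is extremal if its minimum Euclidean weight, the least Euclidean
weight of its nonzero codewords, is `8 ⌊n / 24⌋ + 8`. -/
def IsExtremalTypeII {n : ℕ} (C : Z4Code n) : Prop :=
  C.IsTypeII ∧ IsLeast {w | ∃ x ∈ C, x ≠ 0 ∧ euclideanWeight x = w} (8 * (n / 24) + 8)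

/-- Two `ℤ₄`-codes are equivalent if one is obtained from the other by a permutation `σ` of the
coordinates followed by sign changes `ε i = ± 1` of certain coordinates. -/
def Equivalent {n : ℕ} (C D : Z4Code n) : Prop :=
  ∃ (σ : Equiv.Perm (Fin n)) (ε : Fin n → ℤˣ),
    (D : Set (Fin n → ZMod 4)) = (fun x i => ε i • x (σ i)) '' (C : Set (Fin n → ZMod 4))

/-- The generator matrix of the code `𝒞♮`. -/
def naturalMatrix : Matrix (Fin 18) (Fin 24) (ZMod 4) :=
  !![1, 1, 1, 1, 1, 1, 1, 1, 1, 1, 1, 1, 1, 1, 1, 1, 0, 0, 0, 0, 0, 0, 0, 0;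
     0, 2, 0, 0, 0, 0, 0, 0, 1, 1, 1, 1, 3, 1, 1, 1, 0, 0, 0, 2, 0, 0, 0, 0;
     1, 1, 1, 1, 1, 1, 1, 1, 0, 0, 0, 0, 0, 0, 0, 0, 1, 1, 1, 1, 1, 1, 1, 1;
     0, 1, 0, 0, 1, 0, 1, 1, 1, 0, 1, 3, 0, 1, 0, 2, 1, 0, 1, 1, 0, 1, 0, 0;
     1, 1, 1, 0, 0, 0, 0, 1, 1, 1, 3, 0, 0, 2, 0, 1, 0, 0, 0, 1, 1, 1, 1, 0;
     0, 1, 1, 1, 1, 0, 0, 0, 3, 0, 2, 0, 0, 1, 1, 1, 0, 1, 1, 1, 1, 0, 0, 0;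
     0, 0, 0, 0, 0, 0, 0, 0, 2, 0, 2, 2, 0, 2, 0, 0, 0, 0, 0, 0, 0, 0, 0, 0;
     0, 0, 0, 0, 0, 0, 0, 0, 2, 2, 2, 0, 0, 0, 0, 2, 0, 0, 0, 0, 0, 0, 0, 0;
     0, 0, 0, 0, 0, 0, 0, 0, 2, 0, 0, 0, 0, 2, 2, 2, 0, 0, 0, 0, 0, 0, 0, 0;
     0, 2, 0, 0, 2, 0, 2, 2, 0, 0, 0, 0, 0, 0, 0, 0, 0, 0, 0, 0, 0, 0, 0, 0;
     2, 2, 2, 0, 0, 0, 0, 2, 0, 0, 0, 0, 0, 0, 0, 0, 0, 0, 0, 0, 0, 0, 0, 0;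
     0, 2, 2, 2, 2, 0, 0, 0, 0, 0, 0, 0, 0, 0, 0, 0, 0, 0, 0, 0, 0, 0, 0, 0;
     0, 2, 0, 0, 0, 0, 0, 2, 2, 0, 2, 0, 0, 0, 0, 0, 0, 0, 0, 0, 0, 0, 0, 0;
     0, 2, 0, 0, 2, 0, 0, 0, 2, 0, 0, 0, 0, 2, 0, 0, 0, 0, 0, 0, 0, 0, 0, 0;
     0, 2, 2, 0, 0, 0, 0, 0, 2, 0, 0, 0, 0, 0, 0, 2, 0, 0, 0, 0, 0, 0, 0, 0;
     0, 2, 0, 0, 0, 0, 0, 2, 0, 0, 0, 0, 0, 0, 0, 0, 0, 0, 0, 2, 0, 2, 0, 0;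
     0, 2, 0, 0, 2, 0, 0, 0, 0, 0, 0, 0, 0, 0, 0, 0, 0, 0, 2, 2, 0, 0, 0, 0;
     0, 2, 2, 0, 0, 0, 0, 0, 0, 0, 0, 0, 0, 0, 0, 0, 0, 0, 0, 2, 2, 0, 0, 0]

/-- The code `𝒞♮` of length `24`, generated by the rows of `naturalMatrix`. -/
def natural : Z4Code 24 := Submodule.span (ZMod 4) (Set.range naturalMatrix.row)

end Z4Code

namespace Z4Code

/-! Let `C` be extremal Type II of length 24 with residue code `R` of dimension 6. Self-duality
makes `R` self-orthogonal and puts `2a` in `C` for every `a ∈ Rᗮ`. Divisibility by 8 then forces `1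
∈ R`, and minimum weight 16 forbids two coordinates that agree on all of `R`. So the coordinates are
24 distinct points of the affine space AG(5,2), with `R` the restrictions of affine functions.
Orthogonality makes the 8 missing points a 3-flat; the 24 points are its three other cosets, and `R`
is unique up to permutation (`exists_equiv_point`).

Next let `D`, `D'` share this standard residue, with lifts `X k ∈ D`, `Y k ∈ D'` of its basis. Their
even words coincide, being twice the dual of the residue. A sign change is multiplication by `1 + s`
with `s` valued in `{0, 2}`, and it carries `D` to `D'` as soon as `∑ p, s p * (lift k p * lift l p)
= X k ⬝ᵥ Y l` for all `k`, `l`. Such an `s` exists when the right side respects the relations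
between products of coordinate functions: symmetry, idempotence, and disjointness of octads 1 and 2.
Symmetry is formal (`dotProduct_symm`), idempotence comes from weights modulo 8 (`dotProduct_self`),
and disjointness uses minimum weight 16 (`sum_other_octad`, `dotProduct_octads`).

That `natural` itself qualifies rests on finite certificates: `splitting` for self-duality,
`residueRow_combination` for the minimum weight. -/

theorem exists_extend_linearIndependent {K V : Type*} [Field K] [AddCommGroup V] [Module K V]
    [FiniteDimensional K V] {m n : ℕ} (h : m ≤ n) (hn : n ≤ Module.finrank K V) (v : Fin m → V)
    (hv : LinearIndependent K v) :
    ∃ v' : Fin n → V, LinearIndependent K v' ∧ ∀ i, v' (Fin.castLE h i) = v i := by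
  induction n, h using Nat.le_induction with
  | base => exact ⟨v, hv, fun i => rfl⟩
  | succ n h ih =>
    obtain ⟨v', hv', he⟩ := ih (by omega)
    obtain ⟨x, hx⟩ := exists_linearIndependent_snoc_of_lt_finrank hv' (by omega)
    refine ⟨Fin.snoc v' x, hx, fun i => ?_⟩
    rw [← he i]
    exact Fin.snoc_castSucc (α := fun _ => V) x v' (Fin.castLE h i)

/-! ### Binary residue codes as point sets in AG(5,2) -/

/-- The affine coordinate functions `1, q₀, …, q₄` on `𝔽₂⁵`. -/
def affine (k : Fin 6) (q : Fin 5 → ZMod 2) : ZMod 2 := Fin.cases 1 q k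

theorem sum_affine_mul_affine :
    ∀ k l : Fin 6, ∑ q : Fin 5 → ZMod 2, affine k q * affine l q = 0 := by
  decide +kernel

/-- The zero excludes the constant 1, so the affine function is nonconstant and takes each value on
a hyperplane of 16 points. -/
theorem card_affine_eq_one : ∀ c : Fin 6 → ZMod 2, c ≠ 0 → (∃ q, ∑ k, c k * affine k q = 0) →
    (Finset.univ.filter fun q => ∑ k, c k * affine k q = 1).card = 16 := by
  decide +kernel

/-- Coordinates for the code: three copies of `𝔽₂³`. -/
abbrev Point : Type := Fin 3 × ZMod 2 × ZMod 2 × ZMod 2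

/-- A basis of the standard binary code on `Point`. -/
def coord (k : Fin 6) (p : Point) : ZMod 2 :=
  ![1, if p.1 = 1 then 1 else 0, if p.1 = 2 then 1 else 0, p.2.1, p.2.2.1, p.2.2.2] k

section Binary

variable {R : BinaryCode 24}

theorem exists_coeff {v : Fin 6 → R} (hR : Module.finrank (ZMod 2) R = 6)
    (hv : LinearIndependent (ZMod 2) v) (a : Fin 24 → ZMod 2) :
    a ∈ R ↔ ∃ c : Fin 6 → ZMod 2, ∀ i, a i = ∑ k, c k * (v k : Fin 24 → ZMod 2) i := by
  constructor
  · intro ha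
    have hs := hv.span_eq_top_of_card_eq_finrank' (by simp [hR])
    have : (⟨a, ha⟩ : R) ∈ Submodule.span (ZMod 2) (Set.range v) := hs ▸ Submodule.mem_top
    obtain ⟨c, hc⟩ := (Submodule.mem_span_range_iff_exists_fun _).1 this
    refine ⟨c, fun i => ?_⟩
    have := congrArg (fun z : R => (z : Fin 24 → ZMod 2) i) hc
    simpa using this.symm
  · rintro ⟨c, hc⟩
    have : a = ((∑ k, c k • v k : R) : Fin 24 → ZMod 2) := by
      ext i; simp [hc i]
    rw [this]
    exact Subtype.property _

theorem injective_columns {v : Fin 6 → R} (hR : Module.finrank (ZMod 2) R = 6)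
    (hv : LinearIndependent (ZMod 2) v) (sep : ∀ i j, i ≠ j → ∃ x ∈ R, x i ≠ x j) {i j : Fin 24}
    (h : ∀ k, (v k : Fin 24 → ZMod 2) i = (v k : Fin 24 → ZMod 2) j) : i = j := by
  by_contra hij
  obtain ⟨x, hx, hne⟩ := sep i j hij
  obtain ⟨c, hc⟩ := (exists_coeff hR hv x).1 hx
  exact hne (by rw [hc, hc]; simp [h])

theorem sum_eq_sum_add_sum_compl_image {ι κ A : Type*} [Fintype ι] [Fintype κ] [DecidableEq κ]
    [AddCommMonoid A] {p : ι → κ} (hp : Function.Injective p) (f : κ → A) :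
    ∑ q, f q = ∑ i, f (p i) + ∑ q : ((Finset.univ.image p)ᶜ : Finset κ), f q := by
  rw [← Finset.sum_add_sum_compl (Finset.univ.image p) f, Finset.sum_image hp.injOn,
    Finset.sum_coe_sort ((Finset.univ.image p)ᶜ) f]

theorem exists_linearIndependent_pair_of_rank_add_two_le {m n K : Type*} [Field K] [Fintype m] [Fintype n] (M : Matrix m n K)
    (h : M.rank + 2 ≤ Fintype.card m) :
    ∃ k₁ k₂ : m → K, LinearIndependent K ![k₁, k₂] ∧
      (∀ q, ∑ k, k₁ k * M k q = 0) ∧ ∀ q, ∑ k, k₂ k * M k q = 0 := by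
  classical
  have hker := LinearMap.finrank_range_add_finrank_ker M.transpose.mulVecLin
  have hr : Module.finrank K (LinearMap.range M.transpose.mulVecLin) = M.rank :=
    Matrix.rank_transpose M
  rw [Module.finrank_fintype_fun_eq_card, hr] at hker
  have hone : 1 < Module.finrank K (LinearMap.ker M.transpose.mulVecLin) := by omega
  have : Nontrivial (LinearMap.ker M.transpose.mulVecLin) :=
    Module.nontrivial_of_finrank_pos (by omega : 0 < Module.finrank K _)
  obtain ⟨x, hx⟩ := exists_ne (0 : LinearMap.ker M.transpose.mulVecLin)
  obtain ⟨y, hy⟩ := exists_linearIndependent_pair_of_one_lt_finrank hone hx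
  have hq : ∀ z : LinearMap.ker M.transpose.mulVecLin, ∀ q, ∑ k, (z : m → K) k * M k q = 0 := by
    intro z q
    have := congrFun (LinearMap.mem_ker.1 z.2) q
    simp only [mul_comm ((z : m → K) _)]
    exact this
  refine ⟨x, y, ?_, hq x, hq y⟩
  have hmap := hy.map' (LinearMap.ker M.transpose.mulVecLin).subtype (Submodule.ker_subtype _)
  have hcomp : (LinearMap.ker M.transpose.mulVecLin).subtype ∘ ![x, y] = ![(x : m → K), y] := by
    ext i
    fin_cases i <;> rfl
  exact hcomp ▸ hmap

/-- The 8 points of AG(5,2) missed by the columns lie in the common zero set of two independent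
affine functions `f`, `g`. On the 24 columns, the complements of `f` and `g` are two disjoint
octads, and a third octad remains. -/
theorem exists_disjoint_octads (hR : Module.finrank (ZMod 2) R = 6) (one : (1 : Fin 24 → ZMod 2) ∈ R)
    (orth : ∀ x ∈ R, ∀ y ∈ R, x ⬝ᵥ y = 0) (sep : ∀ i j, i ≠ j → ∃ x ∈ R, x i ≠ x j) :
    ∃ a ∈ R, ∃ b ∈ R, (∀ i, ¬(a i = 1 ∧ b i = 1)) ∧ (∃ i, a i = 1) ∧ (∃ i, b i = 1) ∧
      ∃ i, a i = 0 ∧ b i = 0 := by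
  classical
  have h1 : LinearIndependent (ZMod 2) ![(⟨1, one⟩ : R)] := by
    refine LinearIndependent.of_subsingleton (v := ![(⟨1, one⟩ : R)]) 0 ?_
    intro h
    have := congrArg (fun z : R => (z : Fin 24 → ZMod 2) 0) h
    simp at this
  obtain ⟨v, hv, hv0⟩ := exists_extend_linearIndependent (n := 6) (by norm_num) hR.ge _ h1
  have hv0 : (v 0 : Fin 24 → ZMod 2) = 1 := congrArg Subtype.val (hv0 0)
  set p : Fin 24 → Fin 5 → ZMod 2 := fun i k => (v k.succ : Fin 24 → ZMod 2) i with hp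
  have haff : ∀ k i, affine k (p i) = (v k : Fin 24 → ZMod 2) i := by
    intro k i
    refine Fin.cases ?_ (fun k => ?_) k
    · rw [hv0]; rfl
    · rfl
  have hinj : Function.Injective p := fun i j h =>
    injective_columns hR hv sep fun k => by rw [← haff, ← haff, h]
  let T := ((Finset.univ.image p)ᶜ : Finset (Fin 5 → ZMod 2))
  have hT : T.card = 8 := by
    rw [Finset.card_compl, Finset.card_image_of_injective _ hinj]
    simp
  let M : Matrix (Fin 6) T (ZMod 2) := fun k q => affine k q
  -- Affine functions are orthogonal over all of AG(5,2), and over the 24 columns by hypothesis,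
  -- hence also over the 8 missing points. So `M` has rank at most 4.
  have hM : M * M.transpose = 0 := by
    ext k l
    have h := sum_eq_sum_add_sum_compl_image hinj (fun q => affine k q * affine l q)
    rw [sum_affine_mul_affine] at h
    simp only [haff] at h
    have h2 := orth _ (v k).2 _ (v l).2
    rw [dotProduct] at h2
    rw [h2, zero_add] at h
    rw [Matrix.mul_apply]
    exact h.symm
  have hrank : M.rank + M.transpose.rank ≤ Fintype.card T :=
    Matrix.rank_add_rank_le_card_of_mul_eq_zero hM
  rw [Fintype.card_coe, hT, Matrix.rank_transpose] at hrank
  obtain ⟨k₁, k₂, hk, hz₁, hz₂⟩ := exists_linearIndependent_pair_of_rank_add_two_le M (by rw [Fintype.card_fin]; omega)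
  -- words of `R` vanishing on the complementary points have weight 16
  have hwt : ∀ c : Fin 6 → ZMod 2, c ≠ 0 → (∀ q : T, ∑ k, c k * affine k q = 0) →
      ∑ i, (if ∑ k, c k * affine k (p i) = 1 then 1 else 0) = 16 := by
    intro c hc h
    obtain ⟨q₀, hq₀⟩ : T.Nonempty := Finset.card_pos.1 (by omega)
    rw [← card_affine_eq_one c hc ⟨q₀, h ⟨q₀, hq₀⟩⟩, Finset.card_filter,
      sum_eq_sum_add_sum_compl_image hinj]
    rw [left_eq_add]
    refine Finset.sum_eq_zero fun q _ => ?_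
    rw [h q]
    rfl
  have h₁ := hwt k₁ (hk.ne_zero 0) hz₁
  have h₂ := hwt k₂ (hk.ne_zero 1) hz₂
  have h₃ := hwt (k₁ + k₂) (fun h => by
      have := LinearIndependent.pair_iff.1 hk 1 1 (by simpa using h)
      exact one_ne_zero this.1) (fun q => by
      have e₁ := hz₁ q
      have e₂ := hz₂ q
      simp only [Pi.add_apply, add_mul, Finset.sum_add_distrib]
      exact (congrArg₂ (· + ·) e₁ e₂).trans (add_zero 0))
  simp only [Pi.add_apply, add_mul, Finset.sum_add_distrib] at h₃
  set f : Fin 24 → ZMod 2 := fun i => ∑ k, k₁ k * affine k (p i) with hf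
  set g : Fin 24 → ZMod 2 := fun i => ∑ k, k₂ k * affine k (p i) with hg
  have hfR : f ∈ R := (exists_coeff hR hv f).2 ⟨k₁, fun i => by simp only [hf, haff]⟩
  have hgR : g ∈ R := (exists_coeff hR hv g).2 ⟨k₂, fun i => by simp only [hg, haff]⟩
  replace h₁ : ∑ i, (if f i = 1 then 1 else 0) = 16 := h₁
  replace h₂ : ∑ i, (if g i = 1 then 1 else 0) = 16 := h₂
  replace h₃ : ∑ i, (if f i + g i = 1 then 1 else 0) = 16 := h₃
  -- Each coordinate lies in 0 or 2 of the supports of `f`, `g`, `f + g`. The total 16 + 16 + 16 = 2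
  -- · 24 leaves no room for 0.
  have hcov : ∀ i, f i = 1 ∨ g i = 1 := by
    by_contra! hne
    obtain ⟨j, hj₁, hj₂⟩ := hne
    have hlt : ∑ i, ((if f i = 1 then 1 else 0) + (if g i = 1 then 1 else 0) +
        (if f i + g i = 1 then 1 else 0)) < ∑ _i : Fin 24, 2 := by
      have key : ∀ x y : ZMod 2, (if x = 1 then 1 else 0) + (if y = 1 then 1 else 0) +
        (if x + y = 1 then 1 else 0) ≤ 2 ∧ (x ≠ 1 → y ≠ 1 → (if x = 1 then 1 else 0) +
          (if y = 1 then 1 else 0) + (if x + y = 1 then 1 else 0) < 2) := by decide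
      exact Finset.sum_lt_sum (fun i _ => (key _ _).1) ⟨j, Finset.mem_univ _, (key _ _).2 hj₁ hj₂⟩
    rw [Finset.sum_add_distrib, Finset.sum_add_distrib, h₁, h₂, h₃] at hlt
    simp at hlt
  have hex : ∀ u : Fin 24 → ZMod 2, ∑ i, (if u i = 1 then 1 else 0) = 16 → ∃ i, u i = 0 := by
    intro u hu
    by_contra! hne
    have key : ∀ x : ZMod 2, x ≠ 0 → x = 1 := by decide
    simp [fun i => key _ (hne i)] at hu
  refine ⟨1 + f, R.add_mem one hfR, 1 + g, R.add_mem one hgR, fun i => ?_, ?_, ?_, ?_⟩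
  · have key : ∀ x y : ZMod 2, (x = 1 ∨ y = 1) → ¬(1 + x = 1 ∧ 1 + y = 1) := by decide
    exact key _ _ (hcov i)
  · obtain ⟨i, hi⟩ := hex f h₁
    exact ⟨i, by simp [hi]⟩
  · obtain ⟨i, hi⟩ := hex g h₂
    exact ⟨i, by simp [hi]⟩
  · obtain ⟨i, hi⟩ := hex (fun i => f i + g i) h₃
    have key : ∀ x y : ZMod 2, (x = 1 ∨ y = 1) → x + y = 0 → 1 + x = 0 ∧ 1 + y = 0 := by decide
    exact ⟨i, key _ _ (hcov i) hi⟩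

theorem exists_equiv_point (hR : Module.finrank (ZMod 2) R = 6) (one : (1 : Fin 24 → ZMod 2) ∈ R)
    (orth : ∀ x ∈ R, ∀ y ∈ R, x ⬝ᵥ y = 0) (sep : ∀ i j, i ≠ j → ∃ x ∈ R, x i ≠ x j) :
    ∃ e : Fin 24 ≃ Point, ∀ a : Fin 24 → ZMod 2,
      a ∈ R ↔ ∃ c : Fin 6 → ZMod 2, ∀ i, a i = ∑ k, c k * coord k (e i) := by
  obtain ⟨a, ha, b, hb, hab, ⟨i₁, hi₁⟩, ⟨i₂, hi₂⟩, i₀, ha₀, hb₀⟩ :=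
    exists_disjoint_octads hR one orth sep
  have hne : ∀ x : ZMod 2, x ≠ 1 → x = 0 := by decide
  have hb₁ : b i₁ = 0 := hne _ fun h => hab i₁ ⟨hi₁, h⟩
  have ha₂ : a i₂ = 0 := hne _ fun h => hab i₂ ⟨h, hi₂⟩
  have hind : LinearIndependent (ZMod 2) ![(⟨1, one⟩ : R), ⟨a, ha⟩, ⟨b, hb⟩] := by
    rw [Fintype.linearIndependent_iff]
    intro c hc
    have hi : ∀ i, c 0 + c 1 * a i + c 2 * b i = 0 := fun i => by
      have := congrArg (fun z : R => (z : Fin 24 → ZMod 2) i) hc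
      simpa [Fin.sum_univ_three] using this
    have e₀ := hi i₀
    have e₁ := hi i₁
    have e₂ := hi i₂
    simp only [ha₀, hb₀, mul_zero, add_zero] at e₀
    simp only [hi₁, hb₁, e₀, mul_zero, mul_one, add_zero, zero_add] at e₁
    simp only [ha₂, hi₂, e₀, mul_zero, mul_one, zero_add] at e₂
    intro i
    fin_cases i
    exacts [e₀, e₁, e₂]
  obtain ⟨v, hv, hve⟩ := exists_extend_linearIndependent (n := 6) (by norm_num) hR.ge _ hind
  have hv0 : (v 0 : Fin 24 → ZMod 2) = 1 := congrArg Subtype.val (hve 0)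
  have hv1 : (v 1 : Fin 24 → ZMod 2) = a := congrArg Subtype.val (hve 1)
  have hv2 : (v 2 : Fin 24 → ZMod 2) = b := congrArg Subtype.val (hve 2)
  -- The first component names the octad; three further basis words give the position inside it.
  -- Separation makes `p` injective, and both sides have 24 elements.
  let p : Fin 24 → Point := fun i => (if a i = 1 then 1 else if b i = 1 then 2 else 0,
    (v 3 : Fin 24 → ZMod 2) i, (v 4 : Fin 24 → ZMod 2) i, (v 5 : Fin 24 → ZMod 2) i)
  have hp : ∀ k i, coord k (p i) = (v k : Fin 24 → ZMod 2) i := by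
    intro k i
    have key : ∀ x y : ZMod 2, ¬(x = 1 ∧ y = 1) →
        (if (if x = 1 then 1 else if y = 1 then 2 else 0 : Fin 3) = 1 then (1 : ZMod 2) else 0) = x ∧
        (if (if x = 1 then 1 else if y = 1 then 2 else 0 : Fin 3) = 2 then (1 : ZMod 2) else 0)
          = y := by decide
    fin_cases k
    · simp [coord, hv0]
    · exact (key _ _ (hab i)).1.trans (congrFun hv1 i).symm
    · exact (key _ _ (hab i)).2.trans (congrFun hv2 i).symm
    · rfl
    · rfl
    · rfl
  have hinj : Function.Injective p := fun i j h =>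
    injective_columns hR hv sep fun k => by rw [← hp, ← hp, h]
  refine ⟨Equiv.ofBijective p ((Fintype.bijective_iff_injective_and_card p).2 ⟨hinj, by simp⟩),
    fun x => ?_⟩
  rw [exists_coeff hR hv]
  simp only [Equiv.ofBijective_apply, hp]

end Binary

/-! ### Inner products of codewords congruent modulo 2 -/

/-- The contribution of one coordinate to the Euclidean weight. -/
def coordWeight : ZMod 4 → ℕ := ![0, 1, 4, 1]

section General

variable {ι : Type*} [Fintype ι]

/-- Extremal Type II codes of length `24`, on an arbitrary index set. -/
structure IsExtremalOn (D : Submodule (ZMod 4) (ι → ZMod 4)) : Prop where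
  self_dual : ∀ x, x ∈ D ↔ ∀ y ∈ D, x ⬝ᵥ y = 0
  dvd : ∀ x ∈ D, 8 ∣ ∑ i, coordWeight (x i)
  le : ∀ x ∈ D, x ≠ 0 → 16 ≤ ∑ i, coordWeight (x i)

theorem dotProduct_eq_zero_of_two_mul {x y : ι → ZMod 4} (hx : ∀ i, 2 * x i = 0)
    (hy : ∀ i, 2 * y i = 0) : x ⬝ᵥ y = 0 := by
  have key : ∀ a b : ZMod 4, 2 * a = 0 → 2 * b = 0 → a * b = 0 := by decide
  exact Finset.sum_eq_zero fun i _ => key _ _ (hx i) (hy i)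

variable {D D' : Submodule (ZMod 4) (ι → ZMod 4)}

theorem IsExtremalOn.dotProduct_eq_zero (hD : IsExtremalOn D) {x y : ι → ZMod 4} (hx : x ∈ D)
    (hy : y ∈ D) : x ⬝ᵥ y = 0 := (hD.self_dual x).1 hx y hy

theorem two_mul_sub {ι : Type*} {x y : ι → ZMod 4} (h : ∀ i, 2 * x i = 2 * y i) (i : ι) :
    2 * (x - y) i = 0 := by
  rw [Pi.sub_apply, mul_sub, h, sub_self]

theorem torsion_dotProduct (hD : IsExtremalOn D) {x y y' : ι → ZMod 4} (hx : x ∈ D) (h2 : ∀ i, 2 * x i = 0)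
    (hy' : y' ∈ D) (hyy' : ∀ i, 2 * y i = 2 * y' i) : x ⬝ᵥ y = 0 := by
  have := dotProduct_eq_zero_of_two_mul h2 (two_mul_sub hyy')
  rw [dotProduct_sub, hD.dotProduct_eq_zero hx hy', sub_zero] at this
  exact this

theorem two_mul_dotProduct (hD : IsExtremalOn D) {x y y' : ι → ZMod 4} (hx : x ∈ D)
    (hy' : y' ∈ D) (hyy' : ∀ i, 2 * y i = 2 * y' i) : 2 * (x ⬝ᵥ y) = 0 := by
  have : (2 : ZMod 4) • y = (2 : ZMod 4) • y' := funext hyy'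
  rw [← smul_eq_mul, ← dotProduct_smul, this, dotProduct_smul, hD.dotProduct_eq_zero hx hy',
    smul_zero]

/-- Expand `(x - x') ⬝ᵥ (y - y') = 0`, a product of two even words; the mixed products are
2-torsion, so signs do not matter. -/
theorem dotProduct_symm (hD : IsExtremalOn D) (hD' : IsExtremalOn D')
    {x y x' y' : ι → ZMod 4} (hx : x ∈ D) (hy : y ∈ D) (hx' : x' ∈ D')
    (hy' : y' ∈ D') (hxx' : ∀ i, 2 * x i = 2 * x' i) (hyy' : ∀ i, 2 * y i = 2 * y' i) :
    x ⬝ᵥ y' = y ⬝ᵥ x' := by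
  have h := dotProduct_eq_zero_of_two_mul (two_mul_sub hxx') (two_mul_sub hyy')
  rw [sub_dotProduct, dotProduct_sub, dotProduct_sub, hD.dotProduct_eq_zero hx hy,
    hD'.dotProduct_eq_zero hx' hy', dotProduct_comm x' y] at h
  have h2 := two_mul_dotProduct hD hy hx fun i => (hxx' i).symm
  linear_combination -h - h2

/-- Replacing `x` by `x'` changes the weight modulo 8 by 4 for each even coordinate where they
differ, so the number of these is even. Twice this number is `(x - o) ⬝ᵥ (x' - x)`, which therefore
vanishes. -/
theorem dotProduct_self (hD : IsExtremalOn D) (hD' : IsExtremalOn D')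
    {o x x' : ι → ZMod 4} (ho : o ∈ D) (ho1 : ∀ i, 2 * o i = 2) (hx : x ∈ D)
    (hx' : x' ∈ D') (hxx' : ∀ i, 2 * x i = 2 * x' i) : x ⬝ᵥ x' = o ⬝ᵥ x' := by
  let t : ι → ℕ := fun i => if 2 * x i = 0 ∧ x' i ≠ x i then 1 else 0
  have ht : 2 ∣ ∑ i, t i := by
    have h8 : ∀ y : ι → ZMod 4, 8 ∣ ∑ i, coordWeight (y i) →
        ∑ i, (coordWeight (y i) : ZMod 8) = 0 := fun y h => by
      rw [← Nat.cast_sum]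
      exact (ZMod.natCast_eq_zero_iff _ 8).2 h
    have key : ∀ a b : ZMod 4, 2 * a = 2 * b → (coordWeight b : ZMod 8) =
        coordWeight a + 4 * ((if 2 * a = 0 ∧ b ≠ a then 1 else 0 : ℕ) : ZMod 8) := by decide
    have h := h8 x' (hD'.dvd x' hx')
    rw [Finset.sum_congr rfl fun i _ => key _ _ (hxx' i), Finset.sum_add_distrib,
      h8 x (hD.dvd x hx), zero_add, ← Finset.mul_sum, ← Nat.cast_sum] at h
    have h' : ((4 * ∑ i, t i : ℕ) : ZMod 8) = 0 := by push_cast; exact_mod_cast h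
    have := (ZMod.natCast_eq_zero_iff _ 8).1 h'
    omega
  have key : ∀ a b c : ZMod 4, 2 * a = 2 * b → 2 * c = 2 → (a - c) * (b - a) =
      2 * ((if 2 * a = 0 ∧ b ≠ a then 1 else 0 : ℕ) : ZMod 4) := by decide
  have h : (x - o) ⬝ᵥ (x' - x) = 0 := by
    have : (x - o) ⬝ᵥ (x' - x) = ∑ i, 2 * (t i : ZMod 4) :=
      Finset.sum_congr rfl fun i _ => key _ _ _ (hxx' i) (ho1 i)
    obtain ⟨m, hm⟩ := ht
    rw [this, ← Finset.mul_sum, ← Nat.cast_sum, hm]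
    push_cast
    rw [← mul_assoc]
    exact zero_mul _
  rw [sub_dotProduct, dotProduct_sub, dotProduct_sub, hD.dotProduct_eq_zero hx hx,
    hD.dotProduct_eq_zero ho hx, sub_zero, sub_zero] at h
  exact sub_eq_zero.1 h

end General

/-! ### Codes with the standard residue, and sums over octads -/

/-- The coordinate function `coord k`, lifted to `ℤ₄` with values `0` and `1`. -/
def lift (k : Fin 6) (p : Point) : ZMod 4 := ((coord k p).val : ZMod 4)

/-- The words of `D` modulo `2` are the combinations of the coordinate functions. -/
structure HasStandardResidue (D : Submodule (ZMod 4) (Point → ZMod 4)) : Prop where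
  exists_lift : ∀ k, ∃ x ∈ D, ∀ p, 2 * x p = 2 * lift k p
  exists_coeff : ∀ x ∈ D, ∃ c : Fin 6 → ZMod 4, ∀ p, 2 * x p = 2 * ∑ k, c k * lift k p

/-- A word with entry `1` at `p`, otherwise supported on the octad `a`, whose products with the
coordinate functions of `𝔽₂³` and with the characteristic function of `a` are even. -/
def correction (a : Fin 3) (p q : Point) : ZMod 4 :=
  (if q = p then 1 else 0) + (if q = (a, 1, 0, 0) then lift 3 p else 0) +
  (if q = (a, 0, 1, 0) then lift 4 p else 0) + (if q = (a, 0, 0, 1) then lift 5 p else 0) +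
  (if q = (a, 0, 0, 0) then lift 3 p + lift 4 p + lift 5 p else 0)

theorem correction_mul : ∀ a b : Fin 3, a ≠ 0 → b ≠ 0 → a ≠ b → ∀ p : Point, p.1 ≠ a →
    ∀ k : Fin 6, 2 * ∑ q, correction a p q * lift k q =
      2 * ((if k = 0 then 1 else 0) + (if k = b.castLE (by norm_num) ∧ p.1 = b then 1 else 0)) := by
  decide +kernel

theorem correction_eq : ∀ a : Fin 3, ∀ p q : Point, q.1 ≠ a →
    correction a p q = if q = p then 1 else 0 := by
  decide +kernel

theorem sum_octad : ∀ a : Fin 3, ∑ p : Point, (if p.1 = a then 1 else 0) = 8 := by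
  decide +kernel

variable {D D' : Submodule (ZMod 4) (Point → ZMod 4)}

/-- The product of an even word with `y` depends only on `y` modulo 2, so self-duality need only be
tested on the basis lifts. -/
theorem mem_of_dotProduct_lift (hD : IsExtremalOn D) (hs : HasStandardResidue D)
    {t : Point → ZMod 4} (h2 : ∀ p, 2 * t p = 0) (ht : ∀ k, t ⬝ᵥ lift k = 0) : t ∈ D := by
  rw [hD.self_dual]
  intro y hy
  obtain ⟨c, hc⟩ := hs.exists_coeff y hy
  have h := dotProduct_eq_zero_of_two_mul h2
    (two_mul_sub (x := y) (y := ∑ k, c k • lift k) (by simpa using hc))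
  rw [dotProduct_sub, dotProduct_sum] at h
  simpa [ht] using h

/-- The weight is 8 plus 4 times the number of entries 2, so that number is even. -/
theorem sum_compl_octad (hD : IsExtremalOn D) {a : Fin 3} {x : Point → ZMod 4} (hx : x ∈ D)
    (h2 : ∀ p, 2 * x p = if p.1 = a then 2 else 0) :
    ∑ p : Point, (if p.1 = a then 0 else x p) = 0 := by
  let t : Point → ℕ := fun p => if x p = 2 then 1 else 0
  have hw : ∀ p, coordWeight (x p) = (if p.1 = a then 1 else 0) + 4 * t p := by
    intro p
    have key : ∀ (P : Prop) [Decidable P] (z : ZMod 4), 2 * z = (if P then 2 else 0) →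
        coordWeight z = (if P then 1 else 0) + 4 * (if z = 2 then 1 else 0) := by
      intro P _
      by_cases h : P
      · simp only [h, if_true]; decide
      · simp only [h, if_false]; decide
    exact key _ _ (h2 p)
  have hv : ∀ p, (if p.1 = a then 0 else x p) = 2 * (t p : ZMod 4) := by
    intro p
    have key : ∀ (P : Prop) [Decidable P] (z : ZMod 4), 2 * z = (if P then 2 else 0) →
        (if P then 0 else z) = 2 * ((if z = 2 then 1 else 0 : ℕ) : ZMod 4) := by
      intro P _
      by_cases h : P
      · simp only [h, if_true]; decide
      · simp only [h, if_false]; decide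
    exact key _ _ (h2 p)
  have h8 := hD.dvd x hx
  simp only [hw, Finset.sum_add_distrib, sum_octad, ← Finset.mul_sum] at h8
  obtain ⟨m, hm⟩ : 2 ∣ ∑ p, t p := by omega
  simp only [hv, ← Finset.mul_sum, ← Nat.cast_sum, hm]
  push_cast
  rw [← mul_assoc]
  exact zero_mul _

/-- If the sum were 0, the even entries of `x` off octad `a` could be cancelled by adding an even
codeword, leaving a codeword of weight 8. -/
theorem sum_other_octad (hD : IsExtremalOn D) (hs : HasStandardResidue D) {a b : Fin 3}
    (ha : a ≠ 0) (hb : b ≠ 0) (hab : a ≠ b) {x : Point → ZMod 4} (hx : x ∈ D)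
    (h2 : ∀ p, 2 * x p = if p.1 = a then 2 else 0) :
    ∑ p : Point, (if p.1 = b then x p else 0) = 2 := by
  by_contra hne
  have hsum : ∑ p : Point, (if p.1 = b then x p else 0) = 0 := by
    have htors : 2 * ∑ p : Point, (if p.1 = b then x p else 0) = 0 := by
      rw [Finset.mul_sum]
      refine Finset.sum_eq_zero fun p _ => ?_
      split_ifs with h
      · rw [h2, if_neg (h ▸ hab.symm)]
      · exact mul_zero 2
    have key : ∀ z : ZMod 4, 2 * z = 0 → z ≠ 2 → z = 0 := by decide
    exact key _ htors hne
  set z : Point → ZMod 4 := fun p => if p.1 = a then 0 else x p with hz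
  have hz2 : ∀ p, 2 * z p = 0 := by
    intro p
    simp only [hz]
    split_ifs with h
    · exact mul_zero 2
    · rw [h2, if_neg h]
  have hz0 : ∑ p, z p = 0 := sum_compl_octad hD hx h2
  -- This word agrees with `x` off octad `a`; on `a` it is adjusted so that orthogonality to the
  -- residue reduces to the vanishing of `∑ p, z p` and of the sum over octad `b`.
  let t : Point → ZMod 4 := fun q => ∑ p, z p * correction a p q
  have ht2 : ∀ q, 2 * t q = 0 := by
    intro q
    simp only [t]
    rw [Finset.mul_sum]
    refine Finset.sum_eq_zero fun p _ => ?_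
    rw [← mul_assoc, hz2, zero_mul]
  have htD : t ∈ D := by
    refine mem_of_dotProduct_lift hD hs ht2 fun k => ?_
    have hswap : t ⬝ᵥ lift k = ∑ p, z p * ∑ q, correction a p q * lift k q := by
      simp only [dotProduct, t, Finset.sum_mul, Finset.mul_sum]
      rw [Finset.sum_comm]
      simp only [mul_assoc]
    have key : ∀ z u v : ZMod 4, 2 * z = 0 → 2 * u = 2 * v → z * u = z * v := by decide
    have hterm : ∀ p, z p * ∑ q, correction a p q * lift k q = (if k = 0 then z p else 0) +
        (if k = b.castLE (by norm_num) then (if p.1 = b then x p else 0) else 0) := by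
      intro p
      by_cases hp : p.1 = a
      · have : z p = 0 := if_pos hp
        have hpb : p.1 ≠ b := fun h => hab (hp.symm.trans h)
        simp [this, hpb]
      · rw [key _ _ _ (hz2 p) (correction_mul a b ha hb hab p hp k)]
        have : z p = x p := if_neg hp
        rw [this, mul_add, mul_ite, mul_ite, mul_one, mul_zero, ite_and]
    rw [hswap, Finset.sum_congr rfl fun p _ => hterm p, Finset.sum_add_distrib]
    by_cases hk : k = 0 <;> by_cases hkb : k = b.castLE (by norm_num) <;>
      simp [hk, hkb, hz0, hsum]
  have hcoord : ∀ p, coordWeight ((x + t) p) = if p.1 = a then 1 else 0 := by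
    intro p
    by_cases hp : p.1 = a
    · have key : ∀ u v : ZMod 4, 2 * u = 2 → 2 * v = 0 → coordWeight (u + v) = 1 := by decide
      rw [if_pos hp]
      exact key _ _ (by rw [h2, if_pos hp]) (ht2 p)
    · have : t p = x p := by
        simp only [t]
        simp only [correction_eq a _ p hp, mul_ite, mul_one, mul_zero, Finset.sum_ite_eq,
          Finset.mem_univ, if_true]
        exact if_neg hp
      rw [if_neg hp, Pi.add_apply, this, ← two_mul, h2, if_neg hp]
      rfl
  have hw : ∑ p, coordWeight ((x + t) p) = 8 := by
    simp only [hcoord, sum_octad]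
  have := hD.le (x + t) (D.add_mem hx htD) (by
    intro h0
    have hzero : coordWeight 0 = 0 := rfl
    rw [h0] at hw
    simp [hzero] at hw)
  omega

/-- Only the sums of `x` over octad 2 and of `y` over octad 1 survive, and 2 + 2 = 0. -/
theorem dotProduct_octads (hD : IsExtremalOn D) (hs : HasStandardResidue D)
    (hD' : IsExtremalOn D') (hs' : HasStandardResidue D') {x y : Point → ZMod 4}
    (hx : x ∈ D) (hx2 : ∀ p, 2 * x p = if p.1 = 1 then 2 else 0)
    (hy : y ∈ D') (hy2 : ∀ p, 2 * y p = if p.1 = 2 then 2 else 0) : x ⬝ᵥ y = 0 := by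
  have key : ∀ u : Fin 3, ∀ v w : ZMod 4, 2 * v = (if u = 1 then 2 else 0) →
      2 * w = (if u = 2 then 2 else 0) →
      v * w = (if u = 2 then v else 0) + (if u = 1 then w else 0) := by decide
  rw [dotProduct, Finset.sum_congr rfl fun p _ => key _ _ _ (hx2 p) (hy2 p),
    Finset.sum_add_distrib, sum_other_octad hD hs (by decide) (by decide) (by decide) hx hx2,
    sum_other_octad hD' hs' (by decide) (by decide) (by decide) hy hy2]
  rfl

/-! ### Degree-two functionals and the sign change -/

/-- The index pairs of a basis of the functions of degree at most `2` on `Point`. -/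
def IsBasicPair (i j : Fin 6) : Prop := (i < j ∨ i = 0 ∧ j = 0) ∧ ¬(i = 1 ∧ j = 2)

instance (i j : Fin 6) : Decidable (IsBasicPair i j) := by
  unfold IsBasicPair
  infer_instance

/-- The pair `(i, j)` such that `coord k * coord l` is the basic product `coord i * coord j`. -/
def basicPair (k l : Fin 6) : Fin 6 × Fin 6 := if k = l then (0, k) else (min k l, max k l)

/-- The functional on functions of degree at most `2` dual to `coord i * coord j`. -/
def dualVector (i j : Fin 6) (p : Point) : ZMod 4 :=
  if ∀ k, k ≠ 0 → k ≠ i → k ≠ j → coord k p = 0 then 1 else 0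

/-- Möbius inversion: modulo 2, a coefficient of a polynomial is the sum of its values over the
subcube spanned by the variables of that monomial. -/
theorem sum_dualVector : ∀ i j : Fin 6, IsBasicPair i j → ∀ k l : Fin 6,
    2 * ∑ p, dualVector i j p * (lift k p * lift l p) =
      2 * if (i, j) = basicPair k l then 1 else 0 := by
  decide +kernel

theorem isBasicPair_basicPair : ∀ k l : Fin 6,
    IsBasicPair (basicPair k l).1 (basicPair k l).2 ∨ basicPair k l = (1, 2) := by
  decide

theorem exists_degree_two_functional (β : Fin 6 → Fin 6 → ZMod 4) (h2 : ∀ k l, 2 * β k l = 0)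
    (hsymm : ∀ k l, β k l = β l k) (hdiag : ∀ k, β k k = β 0 k) (h12 : β 1 2 = 0) :
    ∃ s : Point → ZMod 4, (∀ p, 2 * s p = 0) ∧
      ∀ k l, ∑ p, s p * (lift k p * lift l p) = β k l := by
  refine ⟨fun p => ∑ i, ∑ j, if IsBasicPair i j then β i j * dualVector i j p else 0,
    fun p => ?_, fun k l => ?_⟩
  · simp only [Finset.mul_sum]
    refine Finset.sum_eq_zero fun i _ => Finset.sum_eq_zero fun j _ => ?_
    split_ifs
    · rw [← mul_assoc, h2, zero_mul]
    · exact mul_zero 2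
  · have hswap : ∑ p, (∑ i, ∑ j, if IsBasicPair i j then β i j * dualVector i j p else 0) *
        (lift k p * lift l p) = ∑ i, ∑ j, if IsBasicPair i j then
          β i j * ∑ p, dualVector i j p * (lift k p * lift l p) else 0 := by
      simp only [Finset.sum_mul]
      rw [Finset.sum_comm]
      refine Finset.sum_congr rfl fun i _ => ?_
      rw [Finset.sum_comm]
      refine Finset.sum_congr rfl fun j _ => ?_
      split_ifs
      · rw [Finset.mul_sum]
        exact Finset.sum_congr rfl fun p _ => mul_assoc _ _ _
      · simp
    have key : ∀ z u v : ZMod 4, 2 * z = 0 → 2 * u = 2 * v → z * u = z * v := by decide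
    have hterm : ∀ i j, (if IsBasicPair i j then
          β i j * ∑ p, dualVector i j p * (lift k p * lift l p) else 0) =
        if (i, j) = basicPair k l then β (basicPair k l).1 (basicPair k l).2 else 0 := by
      intro i j
      by_cases hij : IsBasicPair i j
      · rw [if_pos hij, key _ _ _ (h2 i j) (sum_dualVector i j hij k l)]
        split_ifs with h
        · rw [← h, mul_one]
        · rw [mul_zero]
      · rw [if_neg hij]
        split_ifs with h
        · rcases isBasicPair_basicPair k l with h' | h'
          · rw [← h] at h'
            exact absurd h' hij
          · rw [h', h12]
        · rfl
    rw [hswap]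
    simp only [hterm]
    rw [← Fintype.sum_prod_type' (f := fun i j => if (i, j) = basicPair k l then
      β (basicPair k l).1 (basicPair k l).2 else 0)]
    simp only [Prod.mk.eta, Finset.sum_ite_eq', Finset.mem_univ, if_true]
    unfold basicPair
    by_cases hkl : k = l
    · rw [if_pos hkl, hkl, hdiag]
    · rw [if_neg hkl]
      rcases le_total k l with h | h
      · rw [min_eq_left h, max_eq_right h]
      · rw [min_eq_right h, max_eq_left h, hsymm]

theorem exists_coeff_torsion (hs : HasStandardResidue D) {X : Fin 6 → Point → ZMod 4}
    (hX : ∀ k, X k ∈ D) (hX2 : ∀ k p, 2 * X k p = 2 * lift k p) {x : Point → ZMod 4} (hx : x ∈ D) :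
    ∃ (c : Fin 6 → ZMod 4) (t : Point → ZMod 4), t ∈ D ∧ (∀ p, 2 * t p = 0) ∧
      x = ∑ k, c k • X k + t := by
  obtain ⟨c, hc⟩ := hs.exists_coeff x hx
  refine ⟨c, x - ∑ k, c k • X k, D.sub_mem hx (D.sum_mem fun k _ => D.smul_mem _ (hX k)),
    two_mul_sub fun p => ?_, by abel⟩
  rw [hc, Finset.sum_apply, Finset.mul_sum, Finset.mul_sum]
  refine Finset.sum_congr rfl fun k _ => ?_
  rw [Pi.smul_apply, smul_eq_mul, mul_left_comm, ← hX2, mul_left_comm]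

theorem exists_signs (hD : IsExtremalOn D) (hs : HasStandardResidue D)
    (hD' : IsExtremalOn D') (hs' : HasStandardResidue D') :
    ∃ ε : Point → ℤˣ, (∀ x ∈ D, (fun p => ε p • x p) ∈ D') ∧
      ∀ y ∈ D', (fun p => ε p • y p) ∈ D := by
  choose X hX hX2 using hs.exists_lift
  choose Y hY hY2 using hs'.exists_lift
  have hXY : ∀ k p, 2 * X k p = 2 * Y k p := fun k p => (hX2 k p).trans (hY2 k p).symm
  obtain ⟨s, hs2, hsβ⟩ := exists_degree_two_functional (fun k l => X k ⬝ᵥ Y l)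
    (fun k l => two_mul_dotProduct hD (hX k) (hX l) fun p => (hXY l p).symm)
    (fun k l => dotProduct_symm hD hD' (hX k) (hX l) (hY k) (hY l) (hXY k) (hXY l))
    (fun k => dotProduct_self hD hD' (hX 0)
      (fun p => by rw [hX2]; rfl) (hX k) (hY k) (hXY k))
    (dotProduct_octads hD hs hD' hs' (hX 1)
      (fun p => by rw [hX2]; revert p; decide) (hY 2) (fun p => by rw [hY2]; revert p; decide))
  have hstors : ∀ {t : Point → ZMod 4}, (∀ p, 2 * t p = 0) → s * t = 0 := fun ht => by
    have key : ∀ a b : ZMod 4, 2 * a = 0 → 2 * b = 0 → a * b = 0 := by decide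
    exact funext fun p => key _ _ (hs2 p) (ht p)
  -- The choice of `s` makes this twice `X k ⬝ᵥ Y l`, which is 0 because `X k ⬝ᵥ Y l` is even.
  have hXYs : ∀ k l, (X k + s * X k) ⬝ᵥ Y l = 0 := by
    intro k l
    have key : ∀ s a b a' b' : ZMod 4, 2 * s = 0 → 2 * a = 2 * a' → 2 * b = 2 * b' →
      s * a * b = s * (a' * b') := by decide
    have h : (s * X k) ⬝ᵥ Y l = X k ⬝ᵥ Y l := by
      rw [← hsβ k l]
      exact Finset.sum_congr rfl fun p _ => key _ _ _ _ _ (hs2 p) (hX2 k p) (hY2 l p)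
    rw [add_dotProduct, h, ← two_mul]
    exact two_mul_dotProduct hD (hX k) (hX l) fun p => (hXY l p).symm
  have hcong : ∀ {x}, x ∈ D → ∃ y ∈ D', ∀ p, 2 * x p = 2 * y p := by
    intro x hx
    obtain ⟨c, hc⟩ := hs.exists_coeff x hx
    refine ⟨∑ k, c k • Y k, D'.sum_mem fun k _ => D'.smul_mem _ (hY k), fun p => ?_⟩
    rw [hc, Finset.sum_apply, Finset.mul_sum, Finset.mul_sum]
    refine Finset.sum_congr rfl fun k _ => ?_
    rw [Pi.smul_apply, smul_eq_mul, mul_left_comm, ← hY2, mul_left_comm]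
  have hcong' : ∀ {y}, y ∈ D' → ∃ x ∈ D, ∀ p, 2 * y p = 2 * x p := by
    intro y hy
    obtain ⟨c, hc⟩ := hs'.exists_coeff y hy
    refine ⟨∑ k, c k • X k, D.sum_mem fun k _ => D.smul_mem _ (hX k), fun p => ?_⟩
    rw [hc, Finset.sum_apply, Finset.mul_sum, Finset.mul_sum]
    refine Finset.sum_congr rfl fun k _ => ?_
    rw [Pi.smul_apply, smul_eq_mul, mul_left_comm, ← hX2, mul_left_comm]
  have hXs : ∀ k, ∀ y ∈ D', (X k + s * X k) ⬝ᵥ y = 0 := by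
    intro k y hy
    obtain ⟨c, t, ht, ht2, rfl⟩ := exists_coeff_torsion hs' hY hY2 hy
    have h : (X k + s * X k) ⬝ᵥ t = 0 := by
      rw [dotProduct_comm]
      refine torsion_dotProduct hD' ht ht2 (hY k) fun p => ?_
      rw [Pi.add_apply, Pi.mul_apply, mul_add, ← mul_assoc, hs2, zero_mul, add_zero, hXY]
    rw [dotProduct_add, dotProduct_sum, h, add_zero]
    refine Finset.sum_eq_zero fun l _ => ?_
    rw [dotProduct_smul, hXYs, smul_zero]
  have hmain : ∀ x ∈ D, ∀ y ∈ D', (x + s * x) ⬝ᵥ y = 0 := by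
    intro x hx y hy
    obtain ⟨c, t, ht, ht2, rfl⟩ := exists_coeff_torsion hs hX hX2 hx
    obtain ⟨y', hy', hyy'⟩ := hcong' hy
    have h : t ⬝ᵥ y = 0 := torsion_dotProduct hD ht ht2 hy' hyy'
    have hsplit : ∑ k, c k • X k + t + s * (∑ k, c k • X k + t) =
        ∑ k, c k • (X k + s * X k) + t := by
      rw [mul_add, hstors ht2, Finset.mul_sum]
      simp only [smul_add, Finset.sum_add_distrib, mul_smul_comm]
      abel
    rw [hsplit, add_dotProduct, sum_dotProduct, h, add_zero]
    refine Finset.sum_eq_zero fun k _ => ?_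
    rw [smul_dotProduct, hXs k y hy, smul_zero]
  -- As `s` takes only the values 0 and 2, `1 + s` is a vector of signs.
  let ε : Point → ℤˣ := fun p => if s p = 0 then 1 else -1
  have hε : ∀ x : Point → ZMod 4, (fun p => ε p • x p) = x + s * x := by
    intro x
    ext p
    have key : ∀ a b : ZMod 4, 2 * a = 0 → a ≠ 0 → -b = b + a * b := by decide
    by_cases h : s p = 0
    · simp [ε, h]
    · simp only [ε, h, if_false, Units.neg_smul, one_smul, Pi.add_apply, Pi.mul_apply]
      exact key _ _ (hs2 p) h
  refine ⟨ε, fun x hx => ?_, fun y hy => ?_⟩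
  · rw [hε, hD'.self_dual]
    exact hmain x hx
  · rw [hε, hD.self_dual]
    intro x hx
    rw [← hmain x hx y hy]
    exact Finset.sum_congr rfl fun p _ => by simp only [Pi.add_apply, Pi.mul_apply]; ring

/-! ### From extremal codes to the standard residue -/

theorem euclideanWeight_eq_sum {n : ℕ} (x : Fin n → ZMod 4) :
    euclideanWeight x = ∑ i, coordWeight (x i) := by
  have key : ∀ z : ZMod 4, coordWeight z =
      (if z = 1 then 1 else 0) + 4 * (if z = 2 then 1 else 0) + (if z = 3 then 1 else 0) := by
    decide
  simp only [euclideanWeight, Finset.card_filter, key, Finset.sum_add_distrib, Finset.mul_sum]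

theorem mem_dual {n : ℕ} {C : Z4Code n} {x : Fin n → ZMod 4} :
    x ∈ C.dual ↔ ∀ y ∈ C, x ⬝ᵥ y = 0 := Iff.rfl

theorem IsExtremalTypeII.isExtremalOn {C : Z4Code 24} (hC : C.IsExtremalTypeII) :
    IsExtremalOn C where
  self_dual x := by
    rw [← mem_dual, ← show C = C.dual from hC.1.1]
  dvd x hx := by
    rw [← euclideanWeight_eq_sum]
    exact hC.1.2 x hx
  le x hx h0 := by
    rw [← euclideanWeight_eq_sum]
    exact hC.2.2 ⟨x, hx, h0, rfl⟩

theorem reduce_eq_iff {n : ℕ} {x y : Fin n → ZMod 4} :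
    reduce x = reduce y ↔ ∀ i, 2 * x i = 2 * y i := by
  have key : ∀ a b : ZMod 4, ZMod.castHom (show 2 ∣ 4 by norm_num) (ZMod 2) a =
      ZMod.castHom (show 2 ∣ 4 by norm_num) (ZMod 2) b ↔ 2 * a = 2 * b := by decide
  rw [funext_iff]
  exact forall_congr' fun i => key _ _

/-- The `0`-`1` lift of a binary word to `ℤ₄`. -/
def liftWord {ι : Type*} (a : ι → ZMod 2) (i : ι) : ZMod 4 := ((a i).val : ZMod 4)

theorem reduce_liftWord {n : ℕ} (a : Fin n → ZMod 2) : reduce (liftWord a) = a := by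
  have key : ∀ z : ZMod 2, ZMod.castHom (show 2 ∣ 4 by norm_num) (ZMod 2) ((z.val : ZMod 4)) = z := by
    decide
  exact funext fun i => key _

theorem reduce_dotProduct {n : ℕ} (x y : Fin n → ZMod 4) : reduce x ⬝ᵥ reduce y =
    ZMod.castHom (show 2 ∣ 4 by norm_num) (ZMod 2) (x ⬝ᵥ y) :=
  (RingHom.map_dotProduct _ x y).symm

theorem two_smul_liftWord_dotProduct {n : ℕ} (a : Fin n → ZMod 2) (y : Fin n → ZMod 4)
    (h : a ⬝ᵥ reduce y = 0) : ((2 : ZMod 4) • liftWord a) ⬝ᵥ y = 0 := by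
  have key : ∀ z : ZMod 4, ZMod.castHom (show 2 ∣ 4 by norm_num) (ZMod 2) z = 0 → 2 * z = 0 := by
    decide
  rw [smul_dotProduct]
  refine key _ ?_
  rw [← reduce_dotProduct, reduce_liftWord, h]

section Residue

variable {C : Z4Code 24}

theorem residue_orthogonal (hC : IsExtremalOn C) :
    ∀ x ∈ C.residue, ∀ y ∈ C.residue, x ⬝ᵥ y = 0 := by
  rintro _ ⟨x, hx, rfl⟩ _ ⟨y, hy, rfl⟩
  rw [reduce_dotProduct, hC.dotProduct_eq_zero hx hy, map_zero]

theorem two_smul_liftWord_mem (hC : IsExtremalOn C) {a : Fin 24 → ZMod 2}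
    (h : ∀ x ∈ C.residue, a ⬝ᵥ x = 0) : (2 : ZMod 4) • liftWord a ∈ C := by
  rw [hC.self_dual]
  exact fun y hy => two_smul_liftWord_dotProduct a y (h _ ⟨y, hy, rfl⟩)

theorem sum_coordWeight_two_smul (a : Fin 24 → ZMod 2) :
    ∑ i, coordWeight (((2 : ZMod 4) • liftWord a) i) = 4 * ∑ i, (a i).val := by
  have key : ∀ z : ZMod 2, coordWeight ((2 : ZMod 4) * (z.val : ZMod 4)) = 4 * z.val := by decide
  rw [Finset.mul_sum]
  exact Finset.sum_congr rfl fun i _ => key _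

theorem sum_eq_zero_of_dvd {ι : Type*} [Fintype ι] (a : ι → ZMod 2)
    (h : 8 ∣ 4 * ∑ i, (a i).val) : ∑ i, a i = 0 := by
  have h2 : 2 ∣ ∑ i, (a i).val := by omega
  have h3 := (ZMod.natCast_eq_zero_iff _ 2).2 h2
  rw [Nat.cast_sum] at h3
  simpa only [ZMod.natCast_zmod_val] using h3

/-- Otherwise some `a` orthogonal to the residue has odd weight, and `2a` is a codeword of weight 4
modulo 8. -/
theorem one_mem_residue (hC : IsExtremalOn C) : (1 : Fin 24 → ZMod 2) ∈ C.residue := by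
  by_contra h
  obtain ⟨f, hf1, hf⟩ := Submodule.exists_le_ker_of_notMem h
  obtain ⟨a, rfl⟩ := (dotProductEquiv (ZMod 2) (Fin 24)).surjective f
  have h8 := hC.dvd _ (two_smul_liftWord_mem hC (a := a) fun x hx => hf hx)
  rw [sum_coordWeight_two_smul] at h8
  apply hf1
  rw [dotProductEquiv_apply_apply, dotProduct_one]
  exact sum_eq_zero_of_dvd a h8

/-- If coordinates `i` and `j` always agreed, the word with entries 2 at `i` and `j` only would be a
codeword of weight 8. -/
theorem residue_separates (hC : IsExtremalOn C) (i j : Fin 24) (hij : i ≠ j) :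
    ∃ x ∈ C.residue, x i ≠ x j := by
  by_contra! h
  have hmem := two_smul_liftWord_mem hC (a := Pi.single i 1 + Pi.single j 1) fun x hx => by
    rw [add_dotProduct, single_one_dotProduct, single_one_dotProduct, h x hx]
    exact CharTwo.add_self_eq_zero _
  have hle := hC.le _ hmem fun h0 => by
    have := congrFun h0 i
    simp [liftWord, hij] at this
    revert this
    decide
  rw [sum_coordWeight_two_smul] at hle
  have hsum : ∑ k, ((Pi.single i 1 + Pi.single j 1 : Fin 24 → ZMod 2) k).val ≤
      ∑ k, ((Pi.single i 1 : Fin 24 → ℕ) k + (Pi.single j 1 : Fin 24 → ℕ) k) := by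
    refine Finset.sum_le_sum fun k _ => ?_
    rw [Pi.add_apply]
    refine (ZMod.val_add_le _ _).trans ?_
    simp only [Pi.single_apply]
    split_ifs <;> decide
  rw [Finset.sum_add_distrib, Finset.sum_pi_single', Finset.sum_pi_single'] at hsum
  simp only [Finset.mem_univ, if_true] at hsum
  omega

/-- Transport of a code along a bijection of the coordinates. -/
def reindex (C : Z4Code 24) (e : Fin 24 ≃ Point) : Submodule (ZMod 4) (Point → ZMod 4) :=
  C.comap (LinearMap.funLeft (ZMod 4) (ZMod 4) e)

theorem mem_reindex {e : Fin 24 ≃ Point} {x : Point → ZMod 4} :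
    x ∈ C.reindex e ↔ x ∘ e ∈ C := Iff.rfl

theorem isExtremalOn_reindex (hC : IsExtremalOn C) (e : Fin 24 ≃ Point) :
    IsExtremalOn (C.reindex e) where
  self_dual x := by
    rw [mem_reindex, hC.self_dual]
    constructor
    · intro h y hy
      rw [← h _ hy]
      exact (Equiv.sum_comp e fun p => x p * y p).symm
    · intro h y hy
      rw [← h (y ∘ e.symm) (by rw [mem_reindex]; convert hy using 1; ext i; simp)]
      rw [dotProduct, dotProduct, ← Equiv.sum_comp e]
      simp
  dvd x hx := by
    rw [← Equiv.sum_comp e]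
    exact hC.dvd _ hx
  le x hx h0 := by
    rw [← Equiv.sum_comp e]
    refine hC.le _ hx fun h => h0 ?_
    ext p
    simpa using congrFun h (e.symm p)

theorem hasStandardResidue_reindex {e : Fin 24 ≃ Point}
    (he : ∀ a : Fin 24 → ZMod 2,
      a ∈ C.residue ↔ ∃ c : Fin 6 → ZMod 2, ∀ i, a i = ∑ k, c k * coord k (e i)) :
    HasStandardResidue (C.reindex e) where
  exists_lift k := by
    obtain ⟨x, hx, hxk⟩ := (he fun i => coord k (e i)).2
      ⟨Pi.single k 1, fun i => by simp [Pi.single_apply]⟩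
    rw [← reduce_liftWord fun i => coord k (e i), reduce_eq_iff] at hxk
    refine ⟨x ∘ e.symm, by rw [mem_reindex]; convert hx using 1; ext i; simp, fun p => ?_⟩
    simpa [liftWord, lift] using hxk (e.symm p)
  exists_coeff x hx := by
    obtain ⟨c, hc⟩ := (he (reduce (x ∘ e))).1 ⟨_, hx, rfl⟩
    refine ⟨fun k => ((c k).val : ZMod 4), fun p => ?_⟩
    have h : reduce (x ∘ e) = reduce fun i => ∑ k, ((c k).val : ZMod 4) * lift k (e i) := by
      ext i
      rw [hc]
      simp only [reduce, map_sum, map_mul]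
      refine Finset.sum_congr rfl fun k _ => ?_
      exact congrArg₂ (· * ·) (congrFun (reduce_liftWord c) k).symm
        (congrFun (reduce_liftWord fun i => coord k (e i)) i).symm
    simpa using reduce_eq_iff.1 h (e.symm p)

end Residue

theorem equivalent_of_isExtremalOn {C D : Z4Code 24} (hC : IsExtremalOn C) (hD : IsExtremalOn D)
    (hC6 : Module.finrank (ZMod 2) C.residue = 6) (hD6 : Module.finrank (ZMod 2) D.residue = 6) :
    Equivalent C D := by
  obtain ⟨e, he⟩ := exists_equiv_point hC6 (one_mem_residue hC) (residue_orthogonal hC)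
    (residue_separates hC)
  obtain ⟨f, hf⟩ := exists_equiv_point hD6 (one_mem_residue hD) (residue_orthogonal hD)
    (residue_separates hD)
  obtain ⟨ε, h₁, h₂⟩ := exists_signs (isExtremalOn_reindex hC e) (hasStandardResidue_reindex he)
    (isExtremalOn_reindex hD f) (hasStandardResidue_reindex hf)
  have hεε : ∀ p (z : ZMod 4), ε p • ε p • z = z := fun p z => by
    rw [smul_smul, Int.units_mul_self, one_smul]
  refine ⟨f.trans e.symm, fun i => ε (f i), Set.ext fun y => ⟨fun hy => ?_, ?_⟩⟩
  · have hy' : y ∘ f.symm ∈ D.reindex f := by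
      rw [mem_reindex]; convert (show y ∈ D from hy) using 1; ext i; simp
    refine ⟨_, h₂ _ hy', ?_⟩
    ext i
    simp [hεε]
  · rintro ⟨x, hx, rfl⟩
    have hx' : x ∘ e.symm ∈ C.reindex e := by
      rw [mem_reindex]; convert (show x ∈ C from hx) using 1; ext i; simp
    exact h₁ _ hx'

/-! ### The code `natural` is extremal Type II with residue dimension 6 -/

/-- Six generators of the residue code of `natural`. -/
def residueRow (j : Fin 6) (i : Fin 24) : ZMod 4 := naturalMatrix (j.castLE (by norm_num)) i

/-- Words whose doubles generate the even-entry part of `natural`. -/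
def torsionRow (j : Fin 18) (i : Fin 24) : ZMod 4 :=
  if j < 6 then naturalMatrix j i else if naturalMatrix j i = 0 then 0 else 1

/-- The coefficients expressing a word of the residue code through its generators. -/
def residueCoeff : Matrix (Fin 6) (Fin 24) (ZMod 4) :=
  !![1, 1, 0, 1, 0, 0, 0, 0, 0, 0, 0, 0, 0, 0, 0, 0, 1, 0, 0, 0, 0, 0, 0, 0;
     0, 0, 1, 0, 0, 0, 0, 0, 1, 0, 0, 0, 0, 0, 0, 0, 1, 0, 0, 0, 0, 0, 0, 0;
     0, 1, 1, 0, 0, 0, 0, 0, 0, 0, 0, 0, 0, 0, 0, 0, 1, 0, 0, 0, 0, 0, 0, 0;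
     0, 1, 1, 0, 0, 0, 0, 0, 0, 0, 0, 0, 0, 0, 0, 0, 0, 0, 0, 0, 0, 0, 0, 0;
     0, 0, 1, 1, 0, 0, 0, 0, 0, 0, 0, 0, 0, 0, 0, 0, 0, 0, 0, 0, 0, 0, 0, 0;
     1, 0, 1, 0, 0, 0, 0, 0, 0, 0, 0, 0, 0, 0, 0, 0, 0, 0, 0, 0, 0, 0, 0, 0]

/-- The coefficients expressing the error of `residueCoeff` through the torsion parity checks. -/
def torsionCoeff : Matrix (Fin 24) (Fin 18) (ZMod 4) :=
  !![0, 0, 0, 0, 0, 0, 0, 0, 0, 0, 0, 0, 0, 0, 0, 0, 0, 0;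
     0, 0, 0, 0, 0, 0, 0, 0, 0, 0, 0, 0, 0, 0, 0, 0, 0, 0;
     0, 0, 0, 0, 0, 0, 0, 0, 0, 0, 0, 0, 0, 0, 0, 0, 0, 0;
     0, 0, 0, 0, 0, 0, 0, 0, 0, 0, 0, 0, 0, 0, 0, 0, 0, 0;
     0, 0, 0, 0, 0, 0, 0, 0, 0, 0, 0, 1, 0, 0, 0, 0, 0, 0;
     1, 1, 0, 0, 0, 0, 0, 0, 0, 1, 0, 0, 0, 0, 0, 0, 0, 0;
     0, 0, 0, 0, 0, 0, 0, 0, 0, 1, 1, 1, 0, 0, 0, 0, 0, 0;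
     0, 0, 0, 0, 0, 0, 0, 0, 0, 0, 1, 0, 0, 0, 0, 0, 0, 0;
     0, 0, 0, 0, 0, 0, 0, 0, 0, 0, 0, 0, 0, 0, 0, 0, 0, 0;
     0, 0, 0, 0, 0, 0, 0, 1, 0, 0, 1, 0, 1, 0, 1, 0, 0, 0;
     0, 0, 0, 0, 0, 0, 0, 0, 0, 0, 1, 0, 1, 0, 0, 0, 0, 0;
     0, 0, 0, 0, 0, 0, 1, 0, 0, 0, 1, 1, 1, 1, 0, 0, 0, 0;
     0, 1, 0, 0, 0, 0, 1, 1, 1, 0, 1, 1, 1, 1, 1, 0, 0, 0;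
     0, 0, 0, 0, 0, 0, 0, 0, 0, 0, 0, 1, 0, 1, 0, 0, 0, 0;
     0, 0, 0, 0, 0, 0, 0, 0, 1, 0, 0, 1, 0, 1, 1, 0, 0, 0;
     0, 0, 0, 0, 0, 0, 0, 0, 0, 0, 0, 0, 0, 0, 1, 0, 0, 0;
     0, 0, 0, 0, 0, 0, 0, 0, 0, 0, 0, 0, 0, 0, 0, 0, 0, 0;
     0, 0, 0, 1, 0, 1, 1, 0, 1, 1, 1, 1, 0, 0, 0, 1, 0, 1;
     0, 0, 0, 1, 0, 0, 1, 0, 0, 1, 1, 0, 0, 0, 0, 1, 0, 0;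
     0, 0, 0, 1, 0, 0, 1, 0, 0, 1, 1, 1, 0, 0, 0, 1, 1, 0;
     0, 0, 0, 1, 0, 0, 1, 0, 0, 1, 1, 1, 0, 0, 0, 1, 1, 1;
     0, 0, 0, 1, 0, 0, 1, 0, 0, 1, 0, 1, 0, 0, 0, 0, 1, 0;
     0, 0, 0, 1, 1, 0, 1, 1, 0, 1, 1, 1, 0, 0, 0, 0, 1, 1;
     1, 1, 1, 0, 1, 1, 0, 1, 1, 0, 1, 1, 0, 0, 0, 0, 0, 1]

/-- A certificate for self-duality: modulo 2, the identity is a part with rows in the residue code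
plus a part factoring through the torsion words. Applied to a dual word it yields a congruent
codeword; applied transposed to an even dual word it yields a torsion combination. -/
theorem splitting : ∀ i l : Fin 24, 2 * (∑ j, residueRow j i * residueCoeff j l +
    ∑ j, torsionCoeff i j * torsionRow j l) = 2 * if i = l then 1 else 0 := by
  decide +kernel

theorem naturalMatrix_orthogonal : ∀ j k : Fin 18, ∑ i, naturalMatrix j i * naturalMatrix k i = 0 := by
  decide +kernel

theorem coordWeight_naturalMatrix : ∀ j : Fin 18, 8 ∣ ∑ i, coordWeight (naturalMatrix j i) := by
  decide +kernel

theorem two_mul_torsionRow : ∀ (j : Fin 18) (i : Fin 24), 2 * torsionRow j i =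
    (if j < 6 then 2 else 1) * naturalMatrix j i := by
  decide +kernel

theorem two_mul_naturalMatrix : ∀ (j : Fin 18) (i : Fin 24), ¬ (j : ℕ) < 6 →
    2 * naturalMatrix j i = 0 := by
  decide +kernel

/-- Each nonzero word of the residue code has weight at least `8`; if the weight is `8`, some
codeword has even entries on its support, with an odd number of entries `2`. -/
theorem residueRow_combination : ∀ c : Fin 6 → ZMod 2, c ≠ 0 →
    8 ≤ ∑ i, (∑ j, c j * ((residueRow j i).val : ZMod 2)).val ∧
    (∑ i, (∑ j, c j * ((residueRow j i).val : ZMod 2)).val = 8 →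
      ∃ d : ZMod 4, (∀ i, ∑ j, c j * ((residueRow j i).val : ZMod 2) = 1 →
        2 * (residueRow 1 i + d * residueRow 0 i) = 0) ∧
      ∑ i, (if ∑ j, c j * ((residueRow j i).val : ZMod 2) = 1 then
        residueRow 1 i + d * residueRow 0 i else 0) = 2) := by
  decide +kernel

theorem residueRow_separates : ∀ i l : Fin 24, i ≠ l →
    ∃ j, 2 * residueRow j i ≠ 2 * residueRow j l := by
  decide +kernel

theorem row_mem_natural (j : Fin 18) : naturalMatrix.row j ∈ natural :=
  Submodule.subset_span ⟨j, rfl⟩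

theorem residueRow_mem_natural (j : Fin 6) : residueRow j ∈ natural :=
  row_mem_natural _

theorem two_smul_torsionRow_mem_natural (j : Fin 18) : (2 : ZMod 4) • torsionRow j ∈ natural := by
  have : (2 : ZMod 4) • torsionRow j = (if j < 6 then 2 else 1 : ZMod 4) • naturalMatrix.row j :=
    funext fun i => two_mul_torsionRow j i
  rw [this]
  exact natural.smul_mem _ (row_mem_natural j)

theorem natural_le_dual : natural ≤ natural.dual := by
  refine Submodule.span_le.2 ?_
  rintro _ ⟨j, rfl⟩
  have h : natural ≤ LinearMap.ker (dotProductEquiv (ZMod 4) (Fin 24) (naturalMatrix.row j)) := by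
    refine Submodule.span_le.2 ?_
    rintro _ ⟨k, rfl⟩
    exact naturalMatrix_orthogonal j k
  exact fun y hy => h hy

theorem exists_torsion_of_mem_dual {x : Fin 24 → ZMod 4} (hx : x ∈ natural.dual) :
    ∃ y ∈ natural, ∀ i, 2 * (x - y) i = 0 := by
  refine ⟨∑ j, (∑ l, residueCoeff j l * x l) • residueRow j,
    natural.sum_mem fun j _ => natural.smul_mem _ (residueRow_mem_natural j), fun i => ?_⟩
  have hA : ∑ l, 2 * (∑ j, torsionCoeff i j * torsionRow j l) * x l = 0 := by
    have : ∑ l, 2 * (∑ j, torsionCoeff i j * torsionRow j l) * x l =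
        ∑ j, torsionCoeff i j * (x ⬝ᵥ ((2 : ZMod 4) • torsionRow j)) := by
      simp only [dotProduct, Finset.mul_sum, Finset.sum_mul, Pi.smul_apply, smul_eq_mul]
      rw [Finset.sum_comm]
      exact Finset.sum_congr rfl fun j _ => Finset.sum_congr rfl fun l _ => by ring
    rw [this]
    exact Finset.sum_eq_zero fun j _ => by
      rw [hx _ (two_smul_torsionRow_mem_natural j), mul_zero]
  have hB : ∑ l, 2 * (∑ j, residueRow j i * residueCoeff j l) * x l =
      2 * ∑ j, (∑ l, residueCoeff j l * x l) * residueRow j i := by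
    simp only [Finset.mul_sum, Finset.sum_mul]
    rw [Finset.sum_comm]
    exact Finset.sum_congr rfl fun j _ => Finset.sum_congr rfl fun l _ => by ring
  have hC : ∑ l, (2 * if i = l then 1 else 0) * x l = 2 * x i := by
    simp
  rw [Finset.sum_congr rfl fun l _ => by rw [← splitting i l]] at hC
  simp only [mul_add, add_mul, Finset.sum_add_distrib] at hC
  rw [hA, hB, add_zero] at hC
  simp only [Pi.sub_apply, Finset.sum_apply, Pi.smul_apply, smul_eq_mul]
  rw [mul_sub, hC, sub_self]

theorem mem_natural_of_torsion {r : Fin 24 → ZMod 4} (hr : r ∈ natural.dual)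
    (h2 : ∀ i, 2 * r i = 0) : r ∈ natural := by
  obtain ⟨z, hz⟩ : ∃ z : Fin 24 → ZMod 4, ∀ i, r i = 2 * z i := by
    have key : ∀ a : ZMod 4, 2 * a = 0 → ∃ b, a = 2 * b := by decide
    choose z hz using fun i => key _ (h2 i)
    exact ⟨z, hz⟩
  have hr' : r = ∑ j, (∑ i, z i * torsionCoeff i j) • ((2 : ZMod 4) • torsionRow j) := by
    ext l
    have hD : ∑ i, z i * (2 * if i = l then 1 else 0) = r l := by
      rw [hz l]
      simp [mul_comm]
    rw [Finset.sum_congr rfl fun i _ => by rw [← splitting i l]] at hD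
    have hG : ∑ i, z i * (2 * ∑ j, residueRow j i * residueCoeff j l) = 0 := by
      have : ∑ i, z i * (2 * ∑ j, residueRow j i * residueCoeff j l) =
          ∑ j, residueCoeff j l * (r ⬝ᵥ residueRow j) := by
        simp only [dotProduct, Finset.mul_sum, hz]
        rw [Finset.sum_comm]
        exact Finset.sum_congr rfl fun j _ => Finset.sum_congr rfl fun i _ => by ring
      rw [this]
      exact Finset.sum_eq_zero fun j _ => by rw [hr _ (residueRow_mem_natural j), mul_zero]
    simp only [mul_add, Finset.sum_add_distrib] at hD
    rw [hG, zero_add] at hD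
    rw [← hD]
    simp only [Finset.sum_apply, Pi.smul_apply, smul_eq_mul, Finset.mul_sum, Finset.sum_mul]
    rw [Finset.sum_comm]
    exact Finset.sum_congr rfl fun j _ => Finset.sum_congr rfl fun i _ => by ring
  rw [hr']
  exact natural.sum_mem fun j _ => natural.smul_mem _ (two_smul_torsionRow_mem_natural j)

theorem natural_isSelfDual : natural.IsSelfDual := by
  refine le_antisymm natural_le_dual fun x hx => ?_
  obtain ⟨y, hy, h2⟩ := exists_torsion_of_mem_dual hx
  have := mem_natural_of_torsion (natural.dual.sub_mem hx (natural_le_dual hy)) h2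
  simpa using natural.add_mem this hy

/-- Modulo 8, `coordWeight` is the square of any integer representative, so the cross term is `2ab`,
and orthogonality makes its sum divisible by 8. -/
theorem sum_coordWeight_add {ι : Type*} [Fintype ι] (x y : ι → ZMod 4) (h : x ⬝ᵥ y = 0) :
    ∑ i, (coordWeight ((x + y) i) : ZMod 8) =
      ∑ i, (coordWeight (x i) : ZMod 8) + ∑ i, (coordWeight (y i) : ZMod 8) := by
  have key : ∀ a b : ZMod 4, (coordWeight (a + b) : ZMod 8) =
      coordWeight a + coordWeight b + 2 * ((a * b).val : ZMod 8) := by decide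
  have h4 : 4 ∣ ∑ i, (x i * y i).val := by
    rw [← ZMod.natCast_eq_zero_iff, Nat.cast_sum]
    simp only [ZMod.natCast_zmod_val]
    exact h
  obtain ⟨m, hm⟩ := h4
  have h8 : 2 * ∑ i, ((x i * y i).val : ZMod 8) = 0 := by
    have h24 : (2 * ((4 : ℕ) : ZMod 8)) = 0 := by decide
    rw [← Nat.cast_sum, hm, Nat.cast_mul, ← mul_assoc, h24, zero_mul]
  simp only [Pi.add_apply, key, Finset.sum_add_distrib, ← Finset.mul_sum]
  rw [h8, add_zero]

theorem sum_coordWeight_smul {ι : Type*} [Fintype ι] (c : ZMod 4) (x : ι → ZMod 4)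
    (h : ∑ i, (coordWeight (x i) : ZMod 8) = 0) :
    ∑ i, (coordWeight ((c • x) i) : ZMod 8) = 0 := by
  have key : ∀ a b : ZMod 4, (a = 0 ∨ a = 1 ∨ a = 2 ∨ a = 3) ∧
      coordWeight (2 * b) = (4 * coordWeight b : ZMod 8) ∧
      coordWeight (3 * b) = coordWeight b := by decide
  rcases (key c 0).1 with rfl | rfl | rfl | rfl
  · simp [show coordWeight 0 = 0 from rfl]
  · simpa using h
  · simp only [Pi.smul_apply, smul_eq_mul, (key 0 _).2.1, ← Finset.mul_sum, h, mul_zero]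
  · simp only [Pi.smul_apply, smul_eq_mul, (key 0 _).2.2, h]

theorem dvd_sum_coordWeight_natural {x : Fin 24 → ZMod 4} (hx : x ∈ natural) :
    8 ∣ ∑ i, coordWeight (x i) := by
  rw [← ZMod.natCast_eq_zero_iff, Nat.cast_sum]
  induction hx using Submodule.span_induction with
  | mem x h =>
    obtain ⟨j, rfl⟩ := h
    rw [← Nat.cast_sum, ZMod.natCast_eq_zero_iff]
    exact coordWeight_naturalMatrix j
  | zero => simp [show coordWeight 0 = 0 from rfl]
  | add x y hx hy ihx ihy =>
    rw [sum_coordWeight_add x y (natural_le_dual hx y hy), ihx, ihy, add_zero]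
  | smul c x hx ih => exact sum_coordWeight_smul c x ih

theorem sum_eq_sum_castLE {A : Type*} [AddCommMonoid A] {m n : ℕ} (h : m ≤ n) (f : Fin n → A)
    (hf : ∀ j : Fin n, ¬ (j : ℕ) < m → f j = 0) : ∑ j, f j = ∑ j, f (Fin.castLE h j) := by
  obtain ⟨k, rfl⟩ := Nat.exists_eq_add_of_le h
  rw [Fin.sum_univ_add, Finset.sum_eq_zero (s := Finset.univ) (f := fun j => f (Fin.natAdd m j)),
    add_zero]
  · rfl
  · exact fun j _ => hf _ (by simp)

theorem exists_residue_coeff {x : Fin 24 → ZMod 4} (hx : x ∈ natural) :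
    ∃ c : Fin 6 → ZMod 2, ∀ i, reduce x i = ∑ j, c j * ((residueRow j i).val : ZMod 2) := by
  obtain ⟨c, rfl⟩ := (Submodule.mem_span_range_iff_exists_fun _).1 hx
  refine ⟨reduce fun j => c (j.castLE (by norm_num)), fun i => ?_⟩
  have h : reduce (∑ j, c j • naturalMatrix.row j) =
      reduce fun i => ∑ j : Fin 6, c (j.castLE (by norm_num)) * residueRow j i := by
    rw [reduce_eq_iff]
    intro i
    rw [Finset.sum_apply, Finset.mul_sum, Finset.mul_sum]
    refine sum_eq_sum_castLE (by norm_num) _ fun j hj => ?_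
    rw [Pi.smul_apply, smul_eq_mul, mul_left_comm]
    exact (congrArg (_ * ·) (two_mul_naturalMatrix j i hj)).trans (mul_zero _)
  rw [h]
  have key : ∀ a : ZMod 4, ZMod.castHom (show 2 ∣ 4 by norm_num) (ZMod 2) a = (a.val : ZMod 2) := by
    decide
  simp only [reduce, map_sum, map_mul]
  simp only [key]

/-- The number of entries 2 is even and nonzero, and it is not 2 because the residue rows separate
coordinates. -/
theorem sixteen_le_of_even {x : Fin 24 → ZMod 4} (hx : x ∈ natural) (h0 : x ≠ 0)
    (h2 : ∀ i, 2 * x i = 0) : 16 ≤ ∑ i, coordWeight (x i) := by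
  let F := Finset.univ.filter fun i => x i = 2
  have hcw : ∑ i, coordWeight (x i) = 4 * F.card := by
    have key : ∀ a : ZMod 4, 2 * a = 0 → coordWeight a = 4 * if a = 2 then 1 else 0 := by decide
    rw [Finset.sum_congr rfl fun i _ => key _ (h2 i), ← Finset.mul_sum, Finset.card_filter]
  have hdot : ∀ y, x ⬝ᵥ y = ∑ i ∈ F, 2 * y i := by
    intro y
    rw [Finset.sum_filter]
    have key : ∀ a b : ZMod 4, 2 * a = 0 → a * b = if a = 2 then 2 * b else 0 := by decide
    exact Finset.sum_congr rfl fun i _ => key _ _ (h2 i)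
  have h8 := dvd_sum_coordWeight_natural hx
  rw [hcw] at h8 ⊢
  have hne : F.card ≠ 0 := by
    intro h
    apply h0
    ext i
    have key : ∀ a : ZMod 4, 2 * a = 0 → a ≠ 2 → a = 0 := by decide
    refine key _ (h2 i) fun hi => ?_
    have : i ∈ F := Finset.mem_filter.2 ⟨Finset.mem_univ i, hi⟩
    rw [Finset.card_eq_zero.1 h] at this
    exact absurd this (Finset.notMem_empty i)
  have hne2 : F.card ≠ 2 := by
    intro h
    obtain ⟨i, l, hil, hF⟩ := Finset.card_eq_two.1 h
    obtain ⟨j, hj⟩ := residueRow_separates i l hil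
    have hzero := natural_le_dual hx _ (residueRow_mem_natural j)
    rw [hdot, hF, Finset.sum_pair hil] at hzero
    have key : ∀ a b : ZMod 4, 2 * a + 2 * b = 0 → 2 * a = 2 * b := by decide
    exact hj (key _ _ hzero)
  omega

theorem sixteen_le {x : Fin 24 → ZMod 4} (hx : x ∈ natural) (h0 : x ≠ 0) :
    16 ≤ ∑ i, coordWeight (x i) := by
  obtain ⟨c, hc⟩ := exists_residue_coeff hx
  by_cases hc0 : c = 0
  · refine sixteen_le_of_even hx h0 fun i => ?_
    have key : ∀ a : ZMod 4, ZMod.castHom (show 2 ∣ 4 by norm_num) (ZMod 2) a = 0 → 2 * a = 0 := by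
      decide
    exact key _ ((hc i).trans (by simp [hc0]))
  obtain ⟨hle, hoct⟩ := residueRow_combination c hc0
  simp only [← hc] at hle hoct
  have hcw : ∑ i, coordWeight (x i) =
      ∑ i, (reduce x i).val + 4 * (Finset.univ.filter fun i => x i = 2).card := by
    have key : ∀ a : ZMod 4, coordWeight a =
        (ZMod.castHom (show 2 ∣ 4 by norm_num) (ZMod 2) a).val + 4 * if a = 2 then 1 else 0 := by
      decide
    rw [Finset.sum_congr rfl fun i _ => key _, Finset.sum_add_distrib, ← Finset.mul_sum,
      Finset.card_filter]
    rfl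
  have h8 := dvd_sum_coordWeight_natural hx
  by_contra! hlt
  -- Weight below 16 means weight 8, so `x` is ±1 on a residue word of weight 8 and 0 elsewhere. The
  -- codeword supplied here is even on that support with an odd number of entries 2, so its product
  -- with `x` would be 2.
  obtain ⟨d, hd2, hd⟩ := hoct (by omega)
  have hno : ∀ i, x i ≠ 2 := by
    have h : (Finset.univ.filter fun i => x i = 2).card = 0 := by omega
    intro i
    simpa using Finset.filter_eq_empty_iff.1 (Finset.card_eq_zero.1 h) (Finset.mem_univ i)
  have hy : residueRow 1 + d • residueRow 0 ∈ natural :=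
    natural.add_mem (residueRow_mem_natural 1) (natural.smul_mem _ (residueRow_mem_natural 0))
  have hzero := natural_le_dual hx _ hy
  have key : ∀ a b : ZMod 4, a ≠ 2 →
      (ZMod.castHom (show 2 ∣ 4 by norm_num) (ZMod 2) a = 1 → 2 * b = 0) →
      a * b = if ZMod.castHom (show 2 ∣ 4 by norm_num) (ZMod 2) a = 1 then b else 0 := by decide
  have hsum : x ⬝ᵥ (residueRow 1 + d • residueRow 0) = 2 :=
    (Finset.sum_congr rfl fun i _ => key _ _ (hno i) (hd2 i)).trans hd
  have h20 : (2 : ZMod 4) = 0 := hsum.symm.trans hzero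
  revert h20
  decide

theorem natural_isExtremalTypeII : natural.IsExtremalTypeII := by
  refine ⟨⟨natural_isSelfDual, fun x hx => ?_⟩, ⟨naturalMatrix.row 6, row_mem_natural 6, ?_, ?_⟩, ?_⟩
  · rw [euclideanWeight_eq_sum]
    exact dvd_sum_coordWeight_natural hx
  · intro h
    have h8 : naturalMatrix 6 8 = 0 := congrFun h 8
    revert h8
    decide
  · rw [euclideanWeight_eq_sum]
    decide +kernel
  · rintro _ ⟨x, hx, h0, rfl⟩
    rw [euclideanWeight_eq_sum]
    exact sixteen_le hx h0

theorem finrank_residue_natural : Module.finrank (ZMod 2) natural.residue = 6 := by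
  have key : ∀ a : ZMod 4, ZMod.castHom (show 2 ∣ 4 by norm_num) (ZMod 2) a = (a.val : ZMod 2) := by
    decide
  have happly : ∀ (c : Fin 6 → ZMod 2) i, (∑ j, c j • reduce (residueRow j)) i =
      ∑ j, c j * ((residueRow j i).val : ZMod 2) := by
    intro c i
    simp only [Finset.sum_apply, Pi.smul_apply, smul_eq_mul, reduce, key]
  have hli : LinearIndependent (ZMod 2) fun j => reduce (residueRow j) := by
    rw [Fintype.linearIndependent_iff]
    intro c hc
    refine congrFun (by_contra fun hne : ¬ c = 0 => ?_)
    have hle := (residueRow_combination c hne).1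
    have hzero : ∀ i, ∑ j, c j * ((residueRow j i).val : ZMod 2) = 0 := fun i => by
      rw [← happly, hc]
      rfl
    simp only [hzero, ZMod.val_zero, Finset.sum_const_zero] at hle
    exact absurd hle (by norm_num)
  have hspan : natural.residue =
      Submodule.span (ZMod 2) (Set.range fun j => reduce (residueRow j)) := by
    refine le_antisymm ?_ (Submodule.span_le.2 ?_)
    · rintro _ ⟨x, hx, rfl⟩
      obtain ⟨c, hc⟩ := exists_residue_coeff hx
      exact (Submodule.mem_span_range_iff_exists_fun _).2
        ⟨c, funext fun i => (happly c i).trans (hc i).symm⟩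
    · rintro _ ⟨j, rfl⟩
      exact ⟨_, residueRow_mem_natural j, rfl⟩
  rw [hspan, finrank_span_eq_card hli, Fintype.card_fin]

end Z4Code

theorem mainTheorem7 :
    (Z4Code.natural.IsExtremalTypeII ∧
      Module.finrank (ZMod 2) Z4Code.natural.residue = 6) ∧
    ∀ C : Z4Code 24, C.IsExtremalTypeII → Module.finrank (ZMod 2) C.residue = 6 →
      Z4Code.Equivalent Z4Code.natural C :=
  ⟨⟨Z4Code.natural_isExtremalTypeII, Z4Code.finrank_residue_natural⟩, fun _ hC hC6 =>
    Z4Code.equivalent_of_isExtremalOn Z4Code.natural_isExtremalTypeII.isExtremalOn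
      hC.isExtremalOn Z4Code.finrank_residue_natural hC6⟩
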